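/- A median algebra is a set $M$ with a ternary operation $m$ such that $m(x,y,z)=m(x,z,y)=m(y,x,z)$, $m(x,x,y)=x$ and $m(m(x,y,z),u,v)=m(x,m(y,u,v),m(z,u,v))$ for all $x,y,z,u,v$. Its intervals are the sets $[x,y]=\{z: m(x,y,z)=z\}$, and a subset is convex if it contains $[x,y]$ for any two of its points $x,y$. A cube is a median algebra isomorphic to $\{0,1\}^n$ (with coordinatewise majority) for some cardinal $n$; it is a finite cube if $n$ is finite. A topological median algebra is a median algebra with a Hausdorff topology for which $m$ is continuous; it is sclocc if it is second countable, compact, and every point has a basis of open convex neighbourhoods. For a topological group $G$, a topological $G$-median algebra is a topological median algebra with an action of $G$ by median automorphisms whose action map $G\times M\to M$ is continuous; a $G$-cube is one whose underlying median algebra is a cube. A morphism of topological $G$-median algebras is a continuous $G$-equivariant map that commutes with $m$. Let $G$ be a topological group and let $M$ be a topological $G$-median algebra that is sclocc, all of whose intervals are countable (possibly finite), and that is minimal, i.e. contains no non-empty proper closed $G$-invariant median subalgebra. Then there exist topological $G$-median algebras $M'$ and $C$, where $C$ is a finite cube, and a $G$-equivariant isomorphism of topological median algebras $M\simeq M'\times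 C$ (with the product topology, the coordinatewise median and the diagonal action), such that for every $G$-cube $C'$ and every surjective morphism $\varphi:M\to C'$ there is a unique morphism $\psi:C\to C'$ such that $\varphi$ is the composition of the projection $M\to C$ and $\psi$. -/

import Mathlib

/-- A median algebra: a set with a ternary operation satisfying the three median axioms. -/
class MedianAlgebra (M : Type*) where
  /-- The median operation. -/
  med : M → M → M → M
  med_swap_right : ∀ x y z : M, med x y z = med x z y
  med_swap_left : ∀ x y z : M, med x y z = med y x z
  med_self : ∀ x y : M, med x x y = x
  med_med : ∀ x y z u v : M, med (med x y z) u v = med x (med y u v) (med z u v)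

namespace MedianAlgebra

/-- The two-point median algebra `{0,1}`, with the majority operation. -/
instance instBool : MedianAlgebra Bool where
  med x y z := (x && y) || (y && z) || (x && z)
  med_swap_right := by decide
  med_swap_left := by decide
  med_self := by decide
  med_med := by decide

/-- Powers of a median algebra, with the coordinatewise operation. -/
instance instPi (ι : Type*) (N : Type*) [MedianAlgebra N] : MedianAlgebra (ι → N) where
  med x y z i := med (x i) (y i) (z i)
  med_swap_right _ _ _ := funext fun _ => med_swap_right _ _ _
  med_swap_left _ _ _ := funext fun _ => med_swap_left _ _ _
  med_self _ _ := funext fun _ => med_self _ _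
  med_med _ _ _ _ _ := funext fun _ => med_med _ _ _ _ _

/-- The product of two median algebras, with the coordinatewise operation. -/
instance instProd (M N : Type*) [MedianAlgebra M] [MedianAlgebra N] : MedianAlgebra (M × N) where
  med x y z := (med x.1 y.1 z.1, med x.2 y.2 z.2)
  med_swap_right _ _ _ := Prod.ext (med_swap_right _ _ _) (med_swap_right _ _ _)
  med_swap_left _ _ _ := Prod.ext (med_swap_left _ _ _) (med_swap_left _ _ _)
  med_self _ _ := Prod.ext (med_self _ _) (med_self _ _)
  med_med _ _ _ _ _ := Prod.ext (med_med _ _ _ _ _) (med_med _ _ _ _ _)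

/-- A map between median algebras commuting with the median operations. -/
def IsMedianMap {M N : Type*} [MedianAlgebra M] [MedianAlgebra N] (f : M → N) : Prop :=
  ∀ x y z : M, f (med x y z) = med (f x) (f y) (f z)

/-- The interval `[x, y]`. -/
def interval {M : Type*} [MedianAlgebra M] (x y : M) : Set M :=
  {z | med x y z = z}

/-- A subset containing the interval between any two of its points. -/
def IsConvex {M : Type*} [MedianAlgebra M] (S : Set M) : Prop :=
  ∀ x ∈ S, ∀ y ∈ S, interval x y ⊆ S

/-- A subset closed under the median operation. -/
def IsSubalgebra {M : Type*} [MedianAlgebra M] (S : Set M) : Prop :=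
  ∀ x ∈ S, ∀ y ∈ S, ∀ z ∈ S, med x y z ∈ S

/-- All intervals are countable (possibly finite). -/
def HasCountableIntervals (M : Type*) [MedianAlgebra M] : Prop :=
  ∀ x y : M, (interval x y).Countable

/-- A cube: a median algebra isomorphic to a (possibly infinite) power of `{0,1}`. -/
def IsCube.{t} (C : Type t) [MedianAlgebra C] : Prop :=
  ∃ (ι : Type t) (e : C ≃ (ι → Bool)), IsMedianMap e

/-- A finite cube: a median algebra isomorphic to `{0,1}^n` for a natural number `n`. -/
def IsFiniteCube (C : Type*) [MedianAlgebra C] : Prop :=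
  ∃ (n : ℕ) (e : C ≃ (Fin n → Bool)), IsMedianMap e

/-- A topological median algebra: Hausdorff, with continuous median operation. -/
structure IsTopological (M : Type*) [TopologicalSpace M] [MedianAlgebra M] : Prop where
  t2 : T2Space M
  continuous_med : Continuous fun p : M × M × M => med p.1 p.2.1 p.2.2

/-- Second countable, locally open-convex and compact. -/
structure IsSclocc (M : Type*) [TopologicalSpace M] [MedianAlgebra M] : Prop
    extends IsTopological M where
  secondCountable : SecondCountableTopology M
  /-- Every point has a basis of open convex neighbourhoods. -/
  locallyOpenConvex : ∀ x : M, ∀ U ∈ nhds x, ∃ V : Set M, IsOpen V ∧ IsConvex V ∧ x ∈ V ∧ V ⊆ U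
  compact : CompactSpace M

/-- A topological `G`-median algebra: a topological median algebra on which `G` acts by
automorphisms such that the action map `G × M → M` is continuous. -/
structure IsTopologicalG (G M : Type*) [Group G] [TopologicalSpace G]
    [TopologicalSpace M] [MedianAlgebra M] [MulAction G M] : Prop
    extends IsTopological M where
  continuous_smul : Continuous fun p : G × M => p.1 • p.2
  isMedianMap_smul : ∀ g : G, IsMedianMap fun x : M => g • x

/-- The action of `G` is minimal: there is no non-empty proper closed `G`-invariant subalgebra. -/
def IsMinimalAction (G M : Type*) [Group G] [TopologicalSpace M] [MedianAlgebra M]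
    [MulAction G M] : Prop :=
  ∀ S : Set M, S.Nonempty → IsClosed S → IsSubalgebra S → (∀ g : G, ∀ x ∈ S, g • x ∈ S) →
    S = Set.univ

/-- A morphism of topological `G`-median algebras: a continuous `G`-equivariant median map. -/
structure IsMorphism (G : Type*) [Group G] {M N : Type*} [TopologicalSpace M] [MedianAlgebra M]
    [MulAction G M] [TopologicalSpace N] [MedianAlgebra N] [MulAction G N] (f : M → N) : Prop where
  continuous : Continuous f
  map_smul : ∀ (g : G) (x : M), f (g • x) = g • f x
  isMedianMap : IsMedianMap f

end MedianAlgebra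

open MedianAlgebra

universe u v w

/-! Call a median map `M → Bool` a wall. Walls separate points, so a point is known from its wall
values. The cube factor records the walls that lie in finite `G`-invariant families of continuous
walls which are pairwise equal, opposite or transverse (all four quadrants non-empty).

Let `W` be such a family, and send each point to its gate (nearest point) in the fiber where every
wall of `W` takes the opposite value. This is a continuous equivariant median endomorphism, so by
minimality it is onto. A wall outside `W` with a side disjoint from a side of a member of `W`
becomes constant along it, hence was constant. So every non-constant wall outside `W`, continuous or
not, is transverse to all of `W` (`transverse_of_not_mem`). Therefore the union `H` of these
families is again transverse, and it is finite: otherwise some interval would contain a copy of an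
infinite power set.

Moving to a gate in a fiber of `H` changes no wall outside `H`, so values on and off `H` can be
prescribed independently, and `M` is the product of one fiber and the cube of values on `H`. If `M`
surjects onto a cube, countable intervals make that cube finite, its non-constant walls pull back
into `H`, and the surjection factors through the cube of values. -/

namespace MedianAlgebra

/-! ### Median identities, walls and Helly's theorem -/

section Algebra

variable {M : Type*} [MedianAlgebra M]

theorem med_self_right (x y : M) : med x y y = y := by
  rw [med_swap_left, med_swap_right, med_self]

theorem med_self_outer (x y : M) : med x y x = x := by
  rw [med_swap_right, med_self]

theorem med_rotate (x y z : M) : med x y z = med y z x := by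
  rw [med_swap_left, med_swap_right]

/-- The retraction onto an interval is idempotent. -/
theorem med_med_retract (a b x : M) : med (med x a b) a b = med x a b := by
  rw [med_med, med_self, med_swap_left b, med_self_right]

/-- The retraction onto an interval is a median map. -/
theorem isMedianMap_retract (a b : M) : IsMedianMap fun x : M => med x a b := by
  intro x y z
  change med (med x y z) a b = med (med x a b) (med y a b) (med z a b)
  rw [← med_med_retract a b (med x y z), med_med x y z, med_swap_left x, med_med,
    med_med_retract, med_swap_left]

theorem med_mem_interval (x y z : M) : med x y z ∈ interval x y := by
  change med x y (med x y z) = med x y z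
  have := med_med_retract x y z
  simpa only [med_rotate z, med_rotate (med x y z)] using this

theorem IsConvex.med_mem {S : Set M} (hS : IsConvex S) {x y : M} (hx : x ∈ S) (hy : y ∈ S)
    (z : M) : med x y z ∈ S :=
  hS x hx y hy (med_mem_interval x y z)

/-- On `interval a b`, `med a` is the meet and `med b` the join; the identities from here to
`med_join_meet` are what the lattice structure and the walls need. -/
theorem med_absorb {a b x : M} (hx : med a b x = x) (y : M) : med a x (med b x y) = x := by
  have h := med_med y b x a x
  rw [med_swap_left b, hx, med_self_outer, med_self_right] at h
  grind [med_swap_left, med_swap_right]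

theorem med_assoc (a x y z : M) : med a (med a x y) z = med a x (med a y z) := by
  have h := med_med x y a a z
  rw [med_self] at h
  grind [med_swap_left, med_swap_right]

theorem med_le_join (b x y z : M) : med b (med x y z) (med b x y) = med b x y := by
  have h := med_med z x y b (med b x y)
  have h1 := med_med_retract x b y
  have h2 := med_med_retract y b x
  grind [med_swap_left, med_swap_right, med_self_right]

theorem med_meet_eq {a x p q : M} (hp : med a x p = x) (hq : med a x q = x) :
    med a p q = med x p q := by
  have ht : med a x (med a p q) = x := by rw [← med_assoc, hp, hq]
  have h1 : med x p q = med x (med a p q) p := by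
    have h := med_med x p a p q
    have h3 : med x p a = x := by grind [med_swap_left, med_swap_right]
    rw [h3, med_self] at h
    grind [med_swap_left, med_swap_right]
  have h2 := med_med x a (med a p q) (med a p q) p
  have h3 : med a (med a p q) p = med a p q := by
    have := med_assoc a p p q
    rw [med_self_right] at this
    grind [med_swap_left, med_swap_right]
  rw [med_self, med_rotate x, med_swap_right a, ht] at h2
  grind [med_swap_left, med_swap_right, med_self_right]

/-- The retraction onto `[b, x]` is a median map sending `a` to `x`; `med_meet_eq` then exchanges
the meet based at `x` for the one based at `a`. -/
theorem med_join_meet {a b x : M} (hx : med a b x = x) (y z : M) :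
    med b x (med a y z) = med a (med b x y) (med b x z) := by
  have h := isMedianMap_retract b x a y z
  have h1 := med_absorb hx y
  have h2 := med_absorb hx z
  rw [med_meet_eq h1 h2]
  grind [med_swap_left, med_swap_right]

theorem isSubalgebra_interval (a b : M) : IsSubalgebra (interval a b) := by
  intro x hx y hy z hz
  have h := isMedianMap_retract a b x y z
  simp only [interval, Set.mem_ofPred_eq] at *
  grind [med_rotate]

theorem left_mem_interval (a b : M) : a ∈ interval a b := med_self_outer a b

theorem right_mem_interval (a b : M) : b ∈ interval a b := med_self_right a b

/-- An interval is a distributive lattice. -/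
@[reducible] def intervalLattice (a b : M) : DistribLattice (interval a b) :=
  letI : Min (interval a b) := ⟨fun x y => ⟨med a x y,
    isSubalgebra_interval a b _ (left_mem_interval a b) _ x.2 _ y.2⟩⟩
  letI : Max (interval a b) := ⟨fun x y => ⟨med b x y,
    isSubalgebra_interval a b _ (right_mem_interval a b) _ x.2 _ y.2⟩⟩
  letI : Lattice (interval a b) := Lattice.mk'
    (fun _ _ => Subtype.ext (med_swap_right _ _ _))
    (fun _ _ _ => Subtype.ext (med_assoc _ _ _ _))
    (fun _ _ => Subtype.ext (med_swap_right _ _ _))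
    (fun _ _ _ => Subtype.ext (med_assoc _ _ _ _))
    (fun x _ => Subtype.ext (med_absorb ((med_swap_left _ _ _).trans x.2) _))
    (fun x _ => Subtype.ext (med_absorb x.2 _))
  { le_sup_inf := fun x y z => le_of_eq (Subtype.ext (med_join_meet x.2 y z).symm) }

theorem IsMedianMap.apply_eq {f : M → Bool} (hf : IsMedianMap f) (x y z : M) :
    f (med x y z) = ((f x && f y) || (f y && f z) || (f x && f z)) :=
  hf x y z

/-- Distinct points of a median algebra are separated by a wall. -/
theorem exists_wall_of_ne {a b : M} (hab : a ≠ b) :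
    ∃ f : M → Bool, IsMedianMap f ∧ f a ≠ f b := by
  classical
  let _ := intervalLattice a b
  have hinf : ∀ x y : interval a b, ((x ⊓ y : interval a b) : M) = med a x y := fun _ _ => rfl
  have hsup : ∀ x y : interval a b, ((x ⊔ y : interval a b) : M) = med b x y := fun _ _ => rfl
  let A : interval a b := ⟨a, left_mem_interval a b⟩
  let B : interval a b := ⟨b, right_mem_interval a b⟩
  have hA : ∀ x, A ≤ x := fun x => by
    rw [← inf_eq_left]; exact Subtype.ext (by rw [hinf]; exact med_self _ _)
  have hB : ∀ x, x ≤ B := fun x => by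
    rw [← sup_eq_right]; exact Subtype.ext (by rw [hsup]; exact med_self_outer _ _)
  have hdisj : Disjoint ((Order.PFilter.principal B : Order.PFilter (interval a b)) :
      Set (interval a b)) (Order.Ideal.principal A : Order.Ideal (interval a b)) := by
    rw [Set.disjoint_left]
    intro x hx hx'
    have h1 : B ≤ x := hx
    have h2 : x ≤ A := hx'
    exact hab (congrArg Subtype.val ((hA B).antisymm (h1.trans h2)))
  -- A prime ideal containing `a` but not `b` is one side of a wall of the interval; the retraction
  -- `r` pulls it back to `M`.
  obtain ⟨J, hJ, hAJ, hBJ⟩ := DistribLattice.prime_ideal_of_disjoint_filter_ideal hdisj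
  have hAm : A ∈ J := hAJ (le_refl A)
  have hBm : B ∉ J := fun h => Set.disjoint_left.1 hBJ (le_refl B) h
  let r : M → interval a b := fun x => ⟨med x a b, by
    rw [med_rotate]; exact med_mem_interval a b x⟩
  have hr : ∀ x y z, ((r (med x y z)) : M) = med (r x : M) (r y) (r z) :=
    isMedianMap_retract a b
  have hle : ∀ x y z, r (med x y z) ≤ r x ⊔ r y := fun x y z => by
    rw [← sup_eq_right]
    exact Subtype.ext (by rw [hsup, hsup, hr]; exact med_le_join b _ _ _)
  have hge : ∀ x y z, r x ⊓ r y ≤ r (med x y z) := fun x y z => by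
    rw [← inf_eq_right]
    exact Subtype.ext (by rw [hinf, hinf, hr]; exact med_le_join a _ _ _)
  have hin : ∀ x y z, r x ∈ J → r y ∈ J → r (med x y z) ∈ J := fun x y z hx hy =>
    J.lower (hle x y z) (Order.Ideal.sup_mem hx hy)
  have hout : ∀ x y z, r x ∉ J → r y ∉ J → r (med x y z) ∉ J := fun x y z hx hy h =>
    (hJ.mem_or_mem (J.lower (hge x y z) h)).elim hx hy
  refine ⟨fun x => decide (r x ∉ J), ?_, ?_⟩
  · intro x y z
    change _ = ((_ && _) || (_ && _) || (_ && _))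
    have h1 := hin x y z
    have h2 := hout x y z
    have h3 := hin y z x
    have h4 := hout y z x
    have h5 := hin x z y
    have h6 := hout x z y
    rw [← med_rotate x y z] at h3 h4
    rw [med_swap_right x z y] at h5 h6
    by_cases hx : r x ∈ J <;> by_cases hy : r y ∈ J <;> by_cases hz : r z ∈ J <;> simp_all
  · have ha : r a = A := Subtype.ext (med_self a b)
    have hb : r b = B := Subtype.ext (med_self_outer b a)
    simp [ha, hb, hAm, hBm]

theorem eq_of_forall_wall {a b : M} (h : ∀ f : M → Bool, IsMedianMap f → f a = f b) : a = b := by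
  by_contra hab
  obtain ⟨f, hf, hfab⟩ := exists_wall_of_ne hab
  exact hfab (h f hf)

/-- The opposite of a wall. -/
theorem IsMedianMap.not {f : M → Bool} (hf : IsMedianMap f) : IsMedianMap fun x => !f x := by
  intro x y z
  change (!f (med x y z)) = _
  rw [hf.apply_eq]
  change _ = ((!f x && !f y) || (!f y && !f z) || (!f x && !f z))
  cases f x <;> cases f y <;> cases f z <;> rfl

theorem IsMedianMap.comp {N P : Type*} [MedianAlgebra N] [MedianAlgebra P] {g : N → P} {f : M → N}
    (hg : IsMedianMap g) (hf : IsMedianMap f) : IsMedianMap (g ∘ f) := fun x y z => by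
  simp only [Function.comp_apply, hf x y z, hg (f x)]

/-- Since walls separate points, it is enough that walls pull back to walls. -/
theorem isMedianMap_of_walls {N : Type*} [MedianAlgebra N] {α : N → M}
    (h : ∀ f : M → Bool, IsMedianMap f → IsMedianMap (f ∘ α)) : IsMedianMap α := fun x y z =>
  eq_of_forall_wall fun f hf => by
    rw [hf (α x) (α y) (α z)]
    exact h f hf x y z

/-- Finitely many pairwise intersecting halfspaces meet, inside any convex set meeting them. -/
theorem helly_aux (s : Finset (M → Bool)) (hs : ∀ f ∈ s, IsMedianMap f)
    (hpair : ∀ f ∈ s, ∀ g ∈ s, ∃ x, f x = true ∧ g x = true) (K : Set M) (hK : IsConvex K)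
    (hne : K.Nonempty) (hKs : ∀ f ∈ s, ∃ x ∈ K, f x = true) :
    ∃ x ∈ K, ∀ f ∈ s, f x = true := by
  classical
  induction s using Finset.induction_on generalizing K with
  | empty => exact hne.imp fun x hx => ⟨hx, by simp⟩
  | insert f s _ ih =>
    simp only [Finset.mem_insert, forall_eq_or_imp] at hs hpair hKs
    have hf := hs.1.apply_eq
    obtain ⟨x, ⟨hxK, hfx⟩, hx⟩ := ih hs.2 (fun f hf g hg => (hpair.2 f hf).2 g hg)
      (K ∩ {x | f x = true})
      (by
        rintro x ⟨hx, hfx⟩ y ⟨hy, hfy⟩ z hz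
        refine ⟨hK x hx y hy hz, ?_⟩
        have h := hf x y z
        rw [show med x y z = z from hz] at h
        simp_all)
      (hKs.1.imp fun x hx => hx)
      (fun g hg => by
        obtain ⟨x, hx, hgx⟩ := hKs.2 g hg
        obtain ⟨y, hy, hfy⟩ := hKs.1
        obtain ⟨z, hfz, hgz⟩ := hpair.1.2 g hg
        -- Each of `K`, `f`, `g` contains two of the three points, hence their median.
        refine ⟨med x y z, ⟨hK.med_mem hx hy z, ?_⟩, ?_⟩
        · simp [hf, hfy, hfz]
        · simp [(hs.2 g hg).apply_eq, hgx, hgz])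
    exact ⟨x, hxK, by simpa [show f x = true from hfx] using hx⟩

/-- Helly's theorem for halfspaces of a median algebra. -/
theorem helly [Nonempty M] {s : Set (M → Bool)} (hfin : s.Finite) (hs : ∀ f ∈ s, IsMedianMap f)
    (hpair : ∀ f ∈ s, ∀ g ∈ s, ∃ x, f x = true ∧ g x = true) : ∃ x, ∀ f ∈ s, f x = true := by
  obtain ⟨x, -, hx⟩ := helly_aux hfin.toFinset (by simpa using hs) (by simpa using hpair) Set.univ
    (fun _ _ _ _ => Set.subset_univ _) Set.univ_nonempty
    (by simpa using fun f hf => (hpair f hf f hf).imp fun _ h => h.1)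
  exact ⟨x, by simpa using hx⟩

/-- Helly's theorem for arbitrary families of clopen halfspaces of a compact median algebra. -/
theorem helly_compact [Nonempty M] [TopologicalSpace M] [CompactSpace M] {s : Set (M → Bool)}
    (hs : ∀ f ∈ s, IsMedianMap f) (hcont : ∀ f ∈ s, Continuous f)
    (hpair : ∀ f ∈ s, ∀ g ∈ s, ∃ x, f x = true ∧ g x = true) : ∃ x, ∀ f ∈ s, f x = true := by
  have := CompactSpace.iInter_nonempty (t := fun f : s => {x | f.1 x = true})
    (fun f => isClosed_singleton.preimage (hcont f.1 f.2)) (fun t => by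
      obtain ⟨x, hx⟩ := helly (s := Subtype.val '' (t : Set s)) (t.finite_toSet.image _)
        (by rintro _ ⟨f, -, rfl⟩; exact hs _ f.2)
        (by rintro _ ⟨f, -, rfl⟩ _ ⟨g, -, rfl⟩; exact hpair _ f.2 _ g.2)
      exact ⟨x, by simpa using fun f hf hft => hx f ⟨⟨f, hf⟩, hft, rfl⟩⟩)
  obtain ⟨x, hx⟩ := this
  exact ⟨x, fun f hf => Set.mem_iInter.1 hx ⟨f, hf⟩⟩

end Algebra

/-! ### Gates in closed convex sets -/

section Gates

variable {M : Type*} [MedianAlgebra M]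

/-- `p` is the gate of `x` in `K`. -/
def IsGate (K : Set M) (x p : M) : Prop :=
  p ∈ K ∧ ∀ y ∈ K, med x y p = p

theorem IsGate.eq {K : Set M} {x p q : M} (hp : IsGate K x p) (hq : IsGate K x q) : p = q := by
  rw [← hp.2 q hq.1, med_swap_right, hq.2 p hp.1]

theorem IsGate.eq_of_mem {K : Set M} {x p : M} (hp : IsGate K x p) (hx : x ∈ K) : p = x := by
  rw [← hp.2 x hx, med_self]

/-- A wall separating a point from its gate separates it from the whole set. -/
theorem IsGate.wall_eq {K : Set M} {x p : M} (hp : IsGate K x p) {f : M → Bool}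
    (hf : IsMedianMap f) (hne : f p ≠ f x) {y : M} (hy : y ∈ K) : f y = f p := by
  have h := hf.apply_eq x y p
  rw [hp.2 y hy] at h
  revert h hne
  cases f p <;> cases f x <;> cases f y <;> decide

theorem isClosed_interval [TopologicalSpace M] (hM : IsTopological M) (x y : M) :
    IsClosed (interval x y) := by
  have := hM.t2
  exact isClosed_eq (hM.continuous_med.comp (by fun_prop : Continuous fun z => (x, y, z)))
    continuous_id

/-- A gate is a common point of the compact sets `interval x y ∩ K` with `y ∈ K`. They are directed:
the one for `med y z x` lies in those for `y` and `z`. -/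
theorem exists_gate [TopologicalSpace M] [CompactSpace M] (hM : IsTopological M) {K : Set M}
    (hK : IsConvex K) (hc : IsClosed K) (hne : K.Nonempty) (x : M) : ∃ p, IsGate K x p := by
  have := hne.to_subtype
  have h := IsCompact.nonempty_iInter_of_directed_nonempty_isCompact_isClosed
    (fun y : K => interval x y.1 ∩ K) ?_ (fun y => ⟨y, right_mem_interval _ _, y.2⟩)
    (fun y => ((isClosed_interval hM _ _).inter hc).isCompact)
    (fun y => (isClosed_interval hM _ _).inter hc)
  · obtain ⟨p, hp⟩ := h
    rw [Set.mem_iInter] at hp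
    exact ⟨p, (hp (Classical.arbitrary K)).2, fun y hy => (hp ⟨y, hy⟩).1⟩
  · rintro ⟨y, hy⟩ ⟨z, hz⟩
    have key : ∀ y z : M, interval x (med y z x) ⊆ interval x y := fun y z t ht =>
      eq_of_forall_wall fun f hf => by
        have h := congrArg f (show med x (med y z x) t = t from ht)
        simp only [hf.apply_eq] at h ⊢
        revert h
        cases f x <;> cases f y <;> cases f z <;> cases f t <;> decide
    refine ⟨⟨med y z x, hK.med_mem hy hz x⟩, fun t ht => ⟨key y z ht.1, ht.2⟩,
      fun t ht => ⟨key z y ?_, ht.2⟩⟩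
    rw [med_swap_left z y]
    exact ht.1

/-- Gates in a locally constant family of convex sets depend continuously on the point. -/
theorem continuous_gate [TopologicalSpace M] [CompactSpace M] (hM : IsTopological M)
    {R : M → Set M} (hR : IsClosed {q : M × M | q.2 ∈ R q.1})
    (hRo : ∀ y, IsOpen {x | y ∈ R x}) {α : M → M} (hα : ∀ x, IsGate (R x) x (α x)) :
    Continuous α := by
  have := hM.t2
  -- The graph is closed, since `y ∈ R x` is an open condition on `x` and occurs only as a premise.
  -- Compactness then gives continuity.
  have hgraph : {q : M × M | q.2 = α q.1} =
      {q : M × M | q.2 ∈ R q.1} ∩ ⋂ y, ({q : M × M | y ∈ R q.1}ᶜ ∪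
        {q : M × M | med q.1 y q.2 = q.2}) := by
    ext ⟨x, p⟩
    simp only [Set.mem_ofPred_eq, Set.mem_inter_iff, Set.mem_iInter, Set.mem_union,
      Set.mem_compl_iff, ← imp_iff_not_or]
    exact ⟨fun h => h ▸ hα x, fun h => IsGate.eq (K := R x) h (hα x)⟩
  have hcl : IsClosed {q : M × M | q.2 = α q.1} := by
    rw [hgraph]
    refine hR.inter (isClosed_iInter fun y => IsClosed.union ?_ ?_)
    · exact ((hRo y).preimage continuous_fst).isClosed_compl
    · exact isClosed_eq (hM.continuous_med.comp
        (by fun_prop : Continuous fun q : M × M => (q.1, y, q.2))) continuous_snd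
  rw [continuous_iff_isClosed]
  intro S hS
  have : α ⁻¹' S = Prod.fst '' ({q : M × M | q.2 = α q.1} ∩ Prod.snd ⁻¹' S) := by
    ext x
    simp
  rw [this]
  exact ((hcl.inter (hS.preimage continuous_snd)).isCompact.image continuous_fst).isClosed

end Gates

/-! ### Transverse families of walls -/

section Cubical

variable {G M : Type*} [Group G] [MedianAlgebra M] [TopologicalSpace M] [MulAction G M]

theorem isMedianMap_const {N P : Type*} [MedianAlgebra N] [MedianAlgebra P] (c : P) :
    IsMedianMap fun _ : N => c := fun _ _ _ => (med_self c c).symm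

theorem not_wall_ne_self {N : Type*} [Nonempty N] (f : N → Bool) : f ≠ fun x => !f x := fun h => by
  have := congrFun h (Classical.arbitrary N)
  simp at this

/-- An invariant family of continuous walls, closed under passing to the opposite wall, any two
of which are equal, opposite, or transverse. -/
structure IsTransverseFamily (G : Type*) {M : Type*} [Group G] [MedianAlgebra M]
    [TopologicalSpace M] [MulAction G M] (W : Set (M → Bool)) : Prop where
  wall : ∀ f ∈ W, IsMedianMap f
  cont : ∀ f ∈ W, Continuous f
  not_mem : ∀ f ∈ W, (fun x => !f x) ∈ W
  smul_mem : ∀ (g : G), ∀ f ∈ W, (fun x => f (g • x)) ∈ W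
  pair : ∀ f ∈ W, ∀ k ∈ W, (k ≠ fun x => !f x) → ∃ x, f x = true ∧ k x = true

/-- The points with prescribed values at the walls of a family. -/
def wallFiber (W : Set (M → Bool)) (c : (M → Bool) → Bool) : Set M :=
  {x | ∀ f ∈ W, f x = c f}

theorem isOpen_mem_wallFiber {N : Type*} [TopologicalSpace N] {W : Set (N → Bool)}
    (hfin : W.Finite) {c : N → (N → Bool) → Bool}
    (hc : ∀ f ∈ W, Continuous fun x => c x f) (y : N) :
    IsOpen {x | y ∈ wallFiber W (c x)} := by
  have : {x | y ∈ wallFiber W (c x)} = ⋂ f ∈ W, (fun x => c x f) ⁻¹' {f y} := by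
    ext
    simp [wallFiber, eq_comm]
  rw [this]
  exact hfin.isOpen_biInter fun f hf => (isOpen_discrete _).preimage (hc f hf)

namespace IsTransverseFamily

variable {W : Set (M → Bool)}

theorem exists_mem [Nonempty M] (hW : IsTransverseFamily G W) {f : M → Bool} (hf : f ∈ W) :
    ∃ x, f x = true :=
  (hW.pair f hf f hf (not_wall_ne_self f)).imp fun _ h => h.1

theorem mem_of_not_mem (hW : IsTransverseFamily G W) {f : M → Bool} (hf : (fun x => !f x) ∈ W) :
    f ∈ W := by
  simpa using hW.not_mem _ hf

theorem pair_of_orientation (hW : IsTransverseFamily G W) {c : (M → Bool) → Bool}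
    (hc : ∀ f ∈ W, c (fun x => !f x) = !c f) :
    ∀ f ∈ {f ∈ W | c f = true}, ∀ k ∈ {f ∈ W | c f = true}, ∃ x, f x = true ∧ k x = true := by
  rintro f ⟨hf, hcf⟩ k ⟨hk, hck⟩
  refine hW.pair f hf k hk ?_
  rintro rfl
  simp [hc f hf, hcf] at hck

theorem mem_wallFiber (hW : IsTransverseFamily G W) {c : (M → Bool) → Bool}
    (hc : ∀ f ∈ W, c (fun x => !f x) = !c f) {x : M} (hx : ∀ f ∈ W, c f = true → f x = true) :
    x ∈ wallFiber W c := fun f hf => by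
  cases hcf : c f with
  | true => exact hx f hf hcf
  | false => simpa using hx _ (hW.not_mem f hf) (by simp [hc f hf, hcf])

/-- Compactness replaces finiteness of `W` here, as this lemma serves to prove that finiteness. -/
theorem wallFiber_nonempty [Nonempty M] [CompactSpace M] (hW : IsTransverseFamily G W)
    {c : (M → Bool) → Bool} (hc : ∀ f ∈ W, c (fun x => !f x) = !c f) :
    (wallFiber W c).Nonempty := by
  obtain ⟨x, hx⟩ := helly_compact (fun f hf => hW.wall f hf.1) (fun f hf => hW.cont f hf.1)
    (hW.pair_of_orientation hc)
  exact ⟨x, hW.mem_wallFiber hc fun f hf hcf => hx f ⟨hf, hcf⟩⟩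

/-- A halfspace meeting all the halfspaces chosen by an orientation meets the fiber of that
orientation. -/
theorem exists_mem_wallFiber [Nonempty M] (hW : IsTransverseFamily G W) (hfin : W.Finite)
    {c : (M → Bool) → Bool} (hc : ∀ f ∈ W, c (fun x => !f x) = !c f) {k : M → Bool}
    (hk : IsMedianMap k) (hne : ∃ x, k x = true)
    (hkW : ∀ f ∈ W, c f = true → ∃ x, f x = true ∧ k x = true) :
    ∃ x ∈ wallFiber W c, k x = true := by
  -- The wall `k` need not be continuous, so only the finite form of Helly applies.
  obtain ⟨x, hx⟩ := helly (s := insert k {f ∈ W | c f = true})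
    ((hfin.subset (Set.sep_subset _ _)).insert k)
    (by
      rintro f (rfl | hf)
      exacts [hk, hW.wall f hf.1])
    (by
      rintro f (rfl | hf) l (rfl | hl)
      · exact hne.imp fun _ h => ⟨h, h⟩
      · exact (hkW l hl.1 hl.2).imp fun _ h => h.symm
      · exact hkW f hf.1 hf.2
      · exact hW.pair_of_orientation hc f hf l hl)
  exact ⟨x, hW.mem_wallFiber hc fun f hf hcf => hx f (Or.inr ⟨hf, hcf⟩), hx k (Or.inl rfl)⟩

theorem isClosed_wallFiber (hW : IsTransverseFamily G W) (c : (M → Bool) → Bool) :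
    IsClosed (wallFiber W c) := by
  have : wallFiber W c = ⋂ f ∈ W, f ⁻¹' {c f} := by ext; simp [wallFiber]
  rw [this]
  exact isClosed_biInter fun f hf => isClosed_singleton.preimage (hW.cont f hf)

theorem isConvex_wallFiber (hW : IsTransverseFamily G W) (c : (M → Bool) → Bool) :
    IsConvex (wallFiber W c) := by
  intro x hx y hy z hz f hf
  have h := (hW.wall f hf).apply_eq x y z
  rw [show med x y z = z from hz, hx f hf, hy f hf] at h
  rw [h]
  cases c f <;> cases f z <;> rfl

theorem isClosed_rel (hW : IsTransverseFamily G W) {c : M → (M → Bool) → Bool}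
    (hc : ∀ f ∈ W, Continuous fun x => c x f) :
    IsClosed {q : M × M | q.2 ∈ wallFiber W (c q.1)} := by
  have : {q : M × M | q.2 ∈ wallFiber W (c q.1)} = ⋂ f ∈ W, {q : M × M | f q.2 = c q.1 f} := by
    ext; simp [wallFiber]
  rw [this]
  exact isClosed_biInter fun f hf =>
    isClosed_eq ((hW.cont f hf).comp continuous_snd) ((hc f hf).comp continuous_fst)

/-- A halfspace outside the family and disjoint from one of its halfspaces contains no gate of a
point in the opposite fiber. -/
theorem wall_gate_eq_false [Nonempty M] (hW : IsTransverseFamily G W) (hfin : W.Finite)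
    {k f : M → Bool} (hk : IsMedianMap k) (hkW : k ∉ W) (hf : f ∈ W)
    (hdisj : ∀ x, f x = true → k x = false) {x p : M}
    (hp : IsGate (wallFiber W fun f => !f x) x p) : k p = false := by
  by_contra hkp
  rw [Bool.not_eq_false] at hkp
  have hfp : f p = false := by
    by_contra h
    simp [hdisj p (by simpa using h)] at hkp
  have hfx : f x = true := by simpa [hfp] using hp.1 f hf
  have hkx := hdisj x hfx
  -- The fiber meets `k = false`: the opposite of `f` does because `k` differs from it, and any
  -- other chosen halfspace meets `f`, which avoids `k`. But a wall separating `x` from its gate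
  -- keeps the whole fiber on the gate's side.
  obtain ⟨y, hy, hky⟩ := hW.exists_mem_wallFiber hfin (c := fun f => !f x) (fun _ _ => rfl) hk.not
    ⟨x, by simp [hkx]⟩ (fun l hl _ => by
      by_cases hlf : l = fun x => !f x
      · obtain ⟨y, hy⟩ := Function.ne_iff.1 (fun h => hkW (h ▸ hW.not_mem f hf) :
          k ≠ fun x => !f x)
        refine ⟨y, ?_⟩
        have := hdisj y
        cases hky : k y <;> cases hfy : f y <;> simp_all
      · exact (hW.pair f hf l hl hlf).imp fun y hy => ⟨hy.2, by simp [hdisj y hy.1]⟩)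
  have := hp.wall_eq hk (by simp [hkp, hkx]) hy
  simp_all

/-- By Helly the fiber meets both sides of `k`, so `k` cannot separate a point from the fiber. -/
theorem wall_gate_eq_self [Nonempty M] (hW : IsTransverseFamily G W) (hfin : W.Finite)
    {k : M → Bool} (hk : IsMedianMap k) (h1 : ∀ f ∈ W, ∃ x, f x = true ∧ k x = true)
    (h0 : ∀ f ∈ W, ∃ x, f x = true ∧ k x = false) {c : (M → Bool) → Bool}
    (hc : ∀ f ∈ W, c (fun x => !f x) = !c f) {x p : M}
    (hp : IsGate (wallFiber W c) x p) : k p = k x := by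
  by_contra hne
  cases hkx : k x with
  | true =>
    obtain ⟨y, hy, hky⟩ := hW.exists_mem_wallFiber hfin hc hk ⟨x, hkx⟩ fun f hf _ => h1 f hf
    have := hp.wall_eq hk hne hy
    simp_all
  | false =>
    obtain ⟨y, hy, hky⟩ := hW.exists_mem_wallFiber hfin hc hk.not ⟨x, by simp [hkx]⟩
      fun f hf _ => by simpa using h0 f hf
    have := hp.wall_eq hk hne hy
    simp_all

/-- If the action is minimal, every wall outside a finite transverse family is transverse to all
walls of the family. -/
theorem transverse_of_not_mem [TopologicalSpace G] [Nonempty M] [CompactSpace M]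
    (hM : IsTopologicalG G M) (hmin : IsMinimalAction G M)
    (hW : IsTransverseFamily G W) (hfin : W.Finite) {k : M → Bool} (hk : IsMedianMap k)
    (hne : ∃ x, k x = true) (hkW : k ∉ W) : ∀ f ∈ W, ∃ x, f x = true ∧ k x = true := by
  have hT := hM.toIsTopological
  have hT2 := hT.t2
  have hgate : ∀ x, ∃ p, IsGate (wallFiber W fun f => !f x) x p := fun x =>
    exists_gate hT (hW.isConvex_wallFiber _) (hW.isClosed_wallFiber _)
      (hW.wallFiber_nonempty fun _ _ => rfl) x
  choose α hα using hgate
  have hcont : Continuous α := by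
    have hc : ∀ f ∈ W, Continuous fun x => !f x := fun f hf =>
      (continuous_of_discreteTopology (f := not)).comp (hW.cont f hf)
    exact continuous_gate hT (hW.isClosed_rel (c := fun x f => !f x) hc)
      (isOpen_mem_wallFiber hfin (c := fun x f => !f x) hc) hα
  have hequiv : ∀ (g : G) x, α (g • x) = g • α x := fun g x => by
    refine (hα (g • x)).eq ⟨fun f hf => (hα x).1 _ (hW.smul_mem g f hf), fun y hy => ?_⟩
    have hy' : g⁻¹ • y ∈ wallFiber W fun f => !f x := fun f hf => by
      simpa using hy _ (hW.smul_mem g⁻¹ f hf)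
    have := hM.isMedianMap_smul g x (g⁻¹ • y) (α x)
    rw [(hα x).2 _ hy'] at this
    simpa using this.symm
  -- Along `α`, walls of `W` become their opposites, walls disjoint from or containing a halfspace
  -- of `W` become constant, and all others are unchanged.
  have hmed : IsMedianMap α := isMedianMap_of_walls fun l hl => by
    by_cases hlW : l ∈ W
    · have : l ∘ α = fun x => !l x := funext fun x => (hα x).1 l hlW
      rw [this]
      exact hl.not
    by_cases h1 : ∃ f ∈ W, ∀ x, f x = true → l x = false
    · obtain ⟨f, hf, hfl⟩ := h1
      have : l ∘ α = fun _ => false :=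
        funext fun x => hW.wall_gate_eq_false hfin hl hlW hf hfl (hα x)
      rw [this]
      exact isMedianMap_const _
    by_cases h2 : ∃ f ∈ W, ∀ x, f x = true → l x = true
    · obtain ⟨f, hf, hfl⟩ := h2
      have : l ∘ α = fun _ => true := funext fun x => by
        simpa using hW.wall_gate_eq_false hfin hl.not (fun h => hlW (hW.mem_of_not_mem h)) hf
          (fun x hx => by simp [hfl x hx]) (hα x)
      rw [this]
      exact isMedianMap_const _
    push Not at h1 h2
    have : l ∘ α = l := funext fun x =>
      hW.wall_gate_eq_self hfin hl (by simpa using h1) (by simpa using h2) (fun _ _ => rfl) (hα x)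
    rwa [this]
  have hrange : Set.range α = Set.univ := hmin _ (Set.range_nonempty α)
    (isCompact_range hcont).isClosed
    (by
      rintro _ ⟨x, rfl⟩ _ ⟨y, rfl⟩ _ ⟨z, rfl⟩
      exact ⟨_, hmed x y z⟩)
    (by
      rintro g _ ⟨x, rfl⟩
      exact ⟨_, hequiv g x⟩)
  intro f hf
  by_contra! h
  obtain ⟨y, hy⟩ := hne
  obtain ⟨x, rfl⟩ := Set.range_eq_univ.1 hrange y
  have := hW.wall_gate_eq_false hfin hk hkW hf (by simpa using h) (hα x)
  simp_all

end IsTransverseFamily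

/-- The union of all finite transverse families. -/
def transverseWalls (G M : Type*) [Group G] [MedianAlgebra M] [TopologicalSpace M]
    [MulAction G M] : Set (M → Bool) :=
  {f | ∃ W, IsTransverseFamily G W ∧ W.Finite ∧ f ∈ W}

/-- For walls from two different families, either both lie in the first or `transverse_of_not_mem`
applies to it. -/
theorem isTransverseFamily_transverseWalls [TopologicalSpace G] [Nonempty M] [CompactSpace M]
    (hM : IsTopologicalG G M) (hmin : IsMinimalAction G M) :
    IsTransverseFamily G (transverseWalls G M) where
  wall := fun f ⟨_, hW, _, hf⟩ => hW.wall f hf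
  cont := fun f ⟨_, hW, _, hf⟩ => hW.cont f hf
  not_mem := fun f ⟨W, hW, hfin, hf⟩ => ⟨W, hW, hfin, hW.not_mem f hf⟩
  smul_mem := fun g f ⟨W, hW, hfin, hf⟩ => ⟨W, hW, hfin, hW.smul_mem g f hf⟩
  pair := by
    rintro f ⟨W, hW, hfin, hf⟩ k ⟨W', hW', -, hk⟩ hfk
    by_cases hkW : k ∈ W
    · exact hW.pair f hf k hkW hfk
    · exact hW.transverse_of_not_mem hM hmin hfin (hW'.wall k hk) (hW'.exists_mem hk) hkW f hf

theorem finite_of_countable_set {α : Type*} [Countable (Set α)] : Finite α := by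
  by_contra h
  rw [not_finite_iff_infinite] at h
  obtain ⟨i, hi⟩ := exists_injective_nat (Set α)
  exact Function.cantor_injective _ ((Infinite.natEmbedding α).injective.comp hi)

/-- Countability of intervals bounds the size of transverse families. -/
theorem IsTransverseFamily.finite [Nonempty M] [CompactSpace M] {W : Set (M → Bool)}
    (hW : IsTransverseFamily G W) (hcount : HasCountableIntervals M) : W.Finite := by
  classical
  let x₀ : M := Classical.arbitrary M
  let W₀ := {f ∈ W | f x₀ = true}
  obtain ⟨y, hy⟩ := hW.wallFiber_nonempty (c := fun f => !f x₀) fun _ _ => rfl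
  have hex : ∀ T : Set (M → Bool), ∃ z ∈ interval x₀ y, ∀ f ∈ W₀, f z = true ↔ f ∈ T := fun T => by
    obtain ⟨z, hz⟩ := hW.wallFiber_nonempty
      (c := fun f => if f x₀ = true then decide (f ∈ T) else !decide ((fun x => !f x) ∈ T))
      (fun f hf => by
        cases hf : f x₀ <;> simp [hf])
    -- Every wall of `W₀` separates `x₀` from `y`, so its value at the median is its value at `z`.
    -- Thus subsets of `W₀` inject into one interval.
    refine ⟨med x₀ y z, med_mem_interval _ _ _, fun f hf => ?_⟩
    have h1 := hy f hf.1
    have h2 := hz f hf.1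
    have h3 : f x₀ = true := hf.2
    rw [(hW.wall f hf.1).apply_eq]
    simp_all
  choose z hz hzT using hex
  have hinj : Function.Injective fun T : Set W₀ =>
      (⟨z (Subtype.val '' T), hz _⟩ : interval x₀ y) := by
    intro S T hST
    have hST' : z (Subtype.val '' S) = z (Subtype.val '' T) := congrArg Subtype.val hST
    ext f
    have h1 := hzT (Subtype.val '' S) f f.2
    have h2 := hzT (Subtype.val '' T) f f.2
    rw [hST'] at h1
    simpa using h1.symm.trans h2
  have := (hcount x₀ y).to_subtype
  have := hinj.countable
  have : Finite W₀ := finite_of_countable_set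
  have hfin : W₀.Finite := W₀.toFinite
  refine (hfin.union (hfin.image fun f x => !f x)).subset fun f hf => ?_
  cases hfx : f x₀ with
  | true => exact Or.inl ⟨hf, hfx⟩
  | false => exact Or.inr ⟨_, ⟨hW.not_mem f hf, by simp [hfx]⟩, by simp⟩

end Cubical

/-! ### Cubes, their walls and induced actions -/

section Cubes

theorem IsCube.exists_antipode {C : Type*} [MedianAlgebra C] (hC : IsCube C) (c : C) :
    ∃ c' : C, ∀ z, med c c' z = z := by
  obtain ⟨ι, e, he⟩ := hC
  refine ⟨e.symm fun i => !e c i, fun z => e.injective (funext fun i => ?_)⟩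
  rw [he, Equiv.apply_symm_apply]
  change ((e c i && !e c i) || (!e c i && e z i) || (e c i && e z i)) = e z i
  cases e c i <;> cases e z i <;> rfl

/-- The interval between lifts of two antipodes maps onto the cube, which is therefore countable;
Cantor's theorem bounds its dimension. -/
theorem IsCube.finite_of_surjective {M C : Type*} [MedianAlgebra M] [MedianAlgebra C]
    (hC : IsCube C) (hcount : HasCountableIntervals M) {φ : M → C} (hφ : IsMedianMap φ)
    (hsurj : Function.Surjective φ) : Finite C := by
  obtain ⟨ι, e, he⟩ := id hC
  let c : C := e.symm fun _ => true
  obtain ⟨c', hc'⟩ := hC.exists_antipode c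
  obtain ⟨x, hx⟩ := hsurj c
  obtain ⟨y, hy⟩ := hsurj c'
  have himage : φ '' interval x y = Set.univ := Set.eq_univ_of_forall fun d => by
    obtain ⟨z, rfl⟩ := hsurj d
    exact ⟨med x y z, med_mem_interval x y z, by rw [hφ, hx, hy, hc']⟩
  have : Countable C := Set.countable_univ_iff.1 (himage ▸ (hcount x y).image φ)
  classical
  have hinj : Function.Injective fun (S : Set ι) (i : ι) => decide (i ∈ S) := fun S T hST => by
    ext i
    simpa using congrFun hST i
  have : Countable (Set ι) := (e.symm.injective.comp hinj).countable
  have : Finite ι := finite_of_countable_set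
  exact Finite.of_equiv _ e.symm

theorem IsTopological.discreteTopology {C : Type*} [TopologicalSpace C] [MedianAlgebra C]
    (hC : IsTopological C) [Finite C] : DiscreteTopology C := by
  have := hC.t2
  infer_instance

variable {G M : Type*} [Group G] [MedianAlgebra M] [TopologicalSpace M] [MulAction G M]

/-- The walls of a cube pull back to walls in the union of the finite transverse families. -/
theorem IsCube.comp_mem_transverseWalls {C : Type*} [TopologicalSpace C] [MedianAlgebra C]
    [MulAction G C] [TopologicalSpace G] (hC : IsCube C) (hCG : IsTopologicalG G C) [Finite C]
    {φ : M → C} (hφ : IsMorphism G φ) (hsurj : Function.Surjective φ) {k : C → Bool}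
    (hk : IsMedianMap k) (h1 : ∃ c, k c = true) (h0 : ∃ c, k c = false) :
    k ∘ φ ∈ transverseWalls G M := by
  have := hCG.toIsTopological.discreteTopology
  refine ⟨(fun l : C → Bool => l ∘ φ) '' {l | IsMedianMap l ∧ (∃ c, l c = true) ∧
    ∃ c, l c = false}, ?_, (Set.toFinite _).image _, k, ⟨hk, h1, h0⟩, rfl⟩
  constructor
  · rintro _ ⟨l, ⟨hl, -⟩, rfl⟩
    exact hl.comp hφ.isMedianMap
  · rintro _ ⟨l, ⟨hl, -⟩, rfl⟩
    exact continuous_of_discreteTopology.comp hφ.continuous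
  · rintro _ ⟨l, ⟨hl, h1, h0⟩, rfl⟩
    exact ⟨fun c => !l c, ⟨hl.not, by simpa using h0, by simpa using h1⟩, rfl⟩
  · rintro g _ ⟨l, ⟨hl, ⟨a, ha⟩, ⟨b, hb⟩⟩, rfl⟩
    exact ⟨fun c => l (g • c), ⟨hl.comp (hCG.isMedianMap_smul g), ⟨g⁻¹ • a, by simpa⟩,
      ⟨g⁻¹ • b, by simpa⟩⟩, funext fun x => by simp [hφ.map_smul]⟩
  · have key : ∀ l : C → Bool, IsMedianMap l → (∃ c, l c = true) → ∀ c c', l c = false →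
        (∀ z, med c c' z = z) → l c' = true := by
      rintro l hl ⟨d, hd⟩ c c' hc hc'
      have h := hl.apply_eq c c' d
      rw [hc', hc, hd] at h
      simpa using h.symm
    rintro _ ⟨l, ⟨hl, hl1, -⟩, rfl⟩ _ ⟨l', ⟨hl', hl1', -⟩, rfl⟩ hne
    obtain ⟨x, hx⟩ := Function.ne_iff.1 hne
    obtain ⟨c', hc'⟩ := hC.exists_antipode (φ x)
    obtain ⟨y, rfl⟩ := hsurj c'
    have h1 := fun h => key l hl hl1 _ _ h hc'
    have h2 := fun h => key l' hl' hl1' _ _ h hc'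
    cases hlx : l (φ x) <;> cases hlx' : l' (φ x)
    · exact ⟨y, h1 hlx, h2 hlx'⟩
    · simp [hlx, hlx'] at hx
    · simp [hlx, hlx'] at hx
    · exact ⟨x, hlx, hlx'⟩

theorem isFiniteCube_pi (ι : Type*) [Finite ι] : IsFiniteCube (ι → Bool) := by
  obtain ⟨n, ⟨e⟩⟩ := Finite.exists_equiv_fin ι
  exact ⟨n, e.arrowCongr (Equiv.refl Bool), fun _ _ _ => rfl⟩

/-- A closed-under-medians subset is a median algebra. -/
@[reducible] def IsSubalgebra.medianAlgebra {N : Type*} [MedianAlgebra N] {S : Set N} (hS : IsSubalgebra S) :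
    MedianAlgebra S where
  med x y z := ⟨med x y z, hS _ x.2 _ y.2 _ z.2⟩
  med_swap_right _ _ _ := Subtype.ext (med_swap_right _ _ _)
  med_swap_left _ _ _ := Subtype.ext (med_swap_left _ _ _)
  med_self _ _ := Subtype.ext (med_self _ _)
  med_med _ _ _ _ _ := Subtype.ext (med_med _ _ _ _ _)

theorem IsConvex.isSubalgebra {N : Type*} [MedianAlgebra N] {S : Set N} (hS : IsConvex S) : IsSubalgebra S :=
  fun _ hx _ hy _ _ => hS.med_mem hx hy _

/-- The action induced on the target of a surjection whose fibers are permuted. -/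
@[reducible] noncomputable def quotientAction {X Y : Type*} [MulAction G X] {f : X → Y}
    (hf : Function.Surjective f) (h : ∀ (g : G) (x y : X), f x = f y → f (g • x) = f (g • y)) :
    MulAction G Y where
  smul g y := f (g • Function.surjInv hf y)
  one_smul y := by
    change f ((1 : G) • Function.surjInv hf y) = y
    rw [one_smul, Function.surjInv_eq hf]
  mul_smul a b y := by
    change f ((a * b) • _) = f (a • _)
    rw [mul_smul]
    exact h a _ _ (Function.surjInv_eq hf _).symm

theorem quotientAction_smul {X Y : Type*} [MulAction G X] {f : X → Y}
    (hf : Function.Surjective f) (h : ∀ (g : G) (x y : X), f x = f y → f (g • x) = f (g • y))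
    (g : G) (x : X) :
    f (g • x) = (letI := quotientAction hf h; g • f x) :=
  h g _ _ (Function.surjInv_eq hf _).symm

/-- An action by automorphisms descends along a surjective equivariant median map. -/
theorem isMedianMap_smul_of_surjective {X Y : Type*} [MedianAlgebra X] [MedianAlgebra Y]
    [MulAction G X] [MulAction G Y] {f : X → Y} (hf : Function.Surjective f) (hm : IsMedianMap f)
    (h : ∀ (g : G) x, f (g • x) = g • f x) (hX : ∀ g : G, IsMedianMap fun x : X => g • x) (g : G) :
    IsMedianMap fun y : Y => g • y := by
  intro a b c
  obtain ⟨x, rfl⟩ := hf a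
  obtain ⟨y, rfl⟩ := hf b
  obtain ⟨z, rfl⟩ := hf c
  simp only [← hm x y z, ← h, hX g x y z]
  exact hm _ _ _

end Cubes

/-! ### The product decomposition -/

section Main

/-- Minimality allows `M` empty. The zero-dimensional cube works, as cubes are non-empty and receive
no surjection from `M`. -/
theorem exists_cube_factor_of_isEmpty (G : Type w) [Group G] [TopologicalSpace G]
    (M : Type u) [TopologicalSpace M] [MedianAlgebra M] [MulAction G M]
    (hM : IsTopologicalG G M) [IsEmpty M] :
    ∃ (M' : Type u) (_ : TopologicalSpace M') (_ : MedianAlgebra M') (_ : MulAction G M')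
      (C : Type u) (_ : TopologicalSpace C) (_ : MedianAlgebra C) (_ : MulAction G C),
      IsTopologicalG G M' ∧ IsTopologicalG G C ∧ IsFiniteCube C ∧
      ∃ e : M ≃ₜ M' × C, IsMorphism G e ∧
        ∀ (C' : Type v) [TopologicalSpace C'] [MedianAlgebra C'] [MulAction G C'],
          IsTopologicalG G C' → IsCube C' →
          ∀ φ : M → C', IsMorphism G φ → Function.Surjective φ →
            ∃! ψ : C → C', IsMorphism G ψ ∧ ∀ x : M, φ x = ψ (e x).2 := by
  let act : MulAction G (PEmpty.{u + 1} → Bool) :=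
    { smul := fun _ c => c, one_smul := fun _ => rfl, mul_smul := fun _ _ _ => rfl }
  let e : M ≃ₜ M × (PEmpty.{u + 1} → Bool) :=
    { toEquiv := Equiv.equivOfIsEmpty _ _
      continuous_toFun := continuous_of_const isEmptyElim
      continuous_invFun := continuous_of_const isEmptyElim }
  refine ⟨M, inferInstance, inferInstance, inferInstance, PEmpty.{u + 1} → Bool, inferInstance,
    inferInstance, act, hM, ⟨⟨inferInstance, ?_⟩, ?_, ?_⟩, isFiniteCube_pi _, e,
    ⟨e.continuous, fun _ => isEmptyElim, isEmptyElim⟩, ?_⟩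
  · exact continuous_of_const fun _ _ => Subsingleton.elim _ _
  · exact continuous_of_const fun _ _ => Subsingleton.elim _ _
  · exact fun _ _ _ _ => Subsingleton.elim _ _
  · intro C' _ _ _ _ hC' φ _ hsurj
    obtain ⟨ι, e', -⟩ := hC'
    exact isEmptyElim (hsurj (e'.symm fun _ => true)).choose

theorem exists_cube_factor_of_nonempty (G : Type w) [Group G] [TopologicalSpace G]
    (M : Type u) [TopologicalSpace M] [MedianAlgebra M] [MulAction G M]
    (hM : IsTopologicalG G M) [CompactSpace M] (hcount : HasCountableIntervals M)
    (hmin : IsMinimalAction G M) [Nonempty M] :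
    ∃ (M' : Type u) (_ : TopologicalSpace M') (_ : MedianAlgebra M') (_ : MulAction G M')
      (C : Type u) (_ : TopologicalSpace C) (_ : MedianAlgebra C) (_ : MulAction G C),
      IsTopologicalG G M' ∧ IsTopologicalG G C ∧ IsFiniteCube C ∧
      ∃ e : M ≃ₜ M' × C, IsMorphism G e ∧
        ∀ (C' : Type v) [TopologicalSpace C'] [MedianAlgebra C'] [MulAction G C'],
          IsTopologicalG G C' → IsCube C' →
          ∀ φ : M → C', IsMorphism G φ → Function.Surjective φ →
            ∃! ψ : C → C', IsMorphism G ψ ∧ ∀ x : M, φ x = ψ (e x).2 := by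
  classical
  have hT := hM.toIsTopological
  have hT2 := hT.t2
  let H := transverseWalls G M
  have hH : IsTransverseFamily G H := isTransverseFamily_transverseWalls hM hmin
  have hfin : H.Finite := hH.finite hcount
  let x₀ : M := Classical.arbitrary M
  let H₀ := {f ∈ H | f x₀ = true}
  have : Finite H₀ := hfin.subset (Set.sep_subset _ _)
  have hgate : ∀ c : (M → Bool) → Bool, (∀ f ∈ H, c (fun x => !f x) = !c f) → ∀ x,
      ∃ p, IsGate (wallFiber H c) x p := fun c hc x =>
    exists_gate hT (hH.isConvex_wallFiber _) (hH.isClosed_wallFiber _)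
      (hH.wallFiber_nonempty hc) x
  have hgate_eq : ∀ c : (M → Bool) → Bool, (∀ f ∈ H, c (fun x => !f x) = !c f) → ∀ x p,
      IsGate (wallFiber H c) x p → ∀ k, IsMedianMap k → k ∉ H → k p = k x := by
    intro c hc x p hp k hk hkH
    by_cases h1 : ∃ y, k y = true
    · by_cases h0 : ∃ y, k y = false
      · refine hH.wall_gate_eq_self hfin hk
          (hH.transverse_of_not_mem hM hmin hfin hk h1 hkH) ?_ hc hp
        simpa using hH.transverse_of_not_mem hM hmin hfin hk.not (by simpa using h0)
          (fun h => hkH (hH.mem_of_not_mem h))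
      · simp only [not_exists, Bool.not_eq_false] at h0
        rw [h0, h0]
    · simp only [not_exists, Bool.not_eq_true] at h1
      rw [h1, h1]
  have hc₀ : ∀ f ∈ H, (fun f : M → Bool => f x₀) (fun x => !f x) = !f x₀ := fun _ _ => rfl
  choose p hp using hgate (fun f => f x₀) hc₀
  let F := wallFiber H fun f => f x₀
  have hF : IsConvex F := hH.isConvex_wallFiber _
  let _ : MedianAlgebra F := hF.isSubalgebra.medianAlgebra
  let π : M → (H₀ → Bool) := fun x f => f.1 x
  let ρ : M → F := fun x => ⟨p x, (hp x).1⟩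
  have hpwall : ∀ x k, IsMedianMap k → k ∉ H → k (p x) = k x := fun x =>
    hgate_eq (fun f => f x₀) hc₀ x _ (hp x)
  have hpF : ∀ x ∈ F, p x = x := fun x hx => (hp x).eq_of_mem hx
  have hpcont : Continuous p := by
    have hc : ∀ f ∈ H, Continuous fun _ : M => f x₀ := fun _ _ => continuous_const
    exact continuous_gate hT (hH.isClosed_rel (c := fun _ f => f x₀) hc)
      (isOpen_mem_wallFiber hfin (c := fun _ f => f x₀) hc) hp
  have hρcont : Continuous ρ := hpcont.subtype_mk _
  have hπcont : Continuous π := continuous_pi fun f => hH.cont f.1 f.2.1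
  have hpmed : IsMedianMap p := isMedianMap_of_walls fun k hk => by
    by_cases hkH : k ∈ H
    · have : k ∘ p = fun _ => k x₀ := funext fun x => (hp x).1 k hkH
      rw [this]
      exact isMedianMap_const _
    · have : k ∘ p = k := funext fun x => hpwall x k hk hkH
      rwa [this]
  have hρmed : IsMedianMap ρ := fun x y z => Subtype.ext (hpmed x y z)
  have hπmed : IsMedianMap π := fun x y z => funext fun f => hH.wall f.1 f.2.1 x y z
  have hρsurj : Function.Surjective ρ := fun y => ⟨y, Subtype.ext (hpF y y.2)⟩
  have hπwall : ∀ x y, π x = π y → ∀ f ∈ H, f x = f y := by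
    intro x y hxy f hf
    by_cases hfx : f x₀ = true
    · exact congrFun hxy ⟨f, hf, hfx⟩
    · simpa [π] using congrFun hxy ⟨fun x => !f x, hH.not_mem f hf, by simpa using hfx⟩
  -- So `ρ` is the quotient by the walls outside `H`, a `G`-invariant set.
  have hρiff : ∀ x y, ρ x = ρ y ↔ ∀ k, IsMedianMap k → k ∉ H → k x = k y := by
    refine fun x y => ⟨fun h k hk hkH => ?_, fun h => Subtype.ext (eq_of_forall_wall fun k hk => ?_)⟩
    · rw [← hpwall x k hk hkH, ← hpwall y k hk hkH, show p x = p y from congrArg Subtype.val h]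
    · by_cases hkH : k ∈ H
      · exact ((hp x).1 k hkH).trans ((hp y).1 k hkH).symm
      · exact (hpwall x k hk hkH).trans ((h k hk hkH).trans (hpwall y k hk hkH).symm)
  have hjoint : ∀ (y : F) (c : H₀ → Bool), ∃ x, ρ x = y ∧ π x = c := by
    intro y c
    -- For `f ∈ H` exactly one of `f` and its opposite lies in `H₀`, so the default `true` is never
    -- used on `H`. The gate of `y` in this fiber is the required point.
    let c' : (M → Bool) → Bool := fun f =>
      if h : f ∈ H₀ then c ⟨f, h⟩ else
        if h : (fun x => !f x) ∈ H₀ then !c ⟨_, h⟩ else true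
    have hc' : ∀ f ∈ H, c' (fun x => !f x) = !c' f := by
      intro f hf
      have hnf := hH.not_mem f hf
      by_cases hfx : f x₀ = true
      · have h1 : f ∈ H₀ := ⟨hf, hfx⟩
        have h2 : (fun x => !f x) ∉ H₀ := fun h => by simpa [hfx] using h.2
        simp [c', h1, h2]
      · have h1 : f ∉ H₀ := fun h => hfx h.2
        have h2 : (fun x => !f x) ∈ H₀ := ⟨hnf, by simpa using hfx⟩
        simp [c', h1, h2]
    obtain ⟨x, hx⟩ := hgate c' hc' y
    refine ⟨x, ?_, funext fun f => ?_⟩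
    · rw [← show ρ y = y from Subtype.ext (hpF y y.2), hρiff]
      exact hgate_eq c' hc' y x hx
    · have := hx.1 f.1 f.2.1
      simpa [c', f.2] using this
  have hπsurj : Function.Surjective π := fun c => (hjoint (ρ x₀) c).imp fun _ h => h.2
  have hρsmul : ∀ (g : G) x y, ρ x = ρ y → ρ (g • x) = ρ (g • y) := by
    intro g x y hxy
    rw [hρiff] at hxy ⊢
    intro k hk hkH
    exact hxy (fun x => k (g • x)) (hk.comp (hM.isMedianMap_smul g))
      fun h => hkH (by simpa using hH.smul_mem g⁻¹ _ h)
  have hπsmul : ∀ (g : G) x y, π x = π y → π (g • x) = π (g • y) := fun g x y hxy =>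
    funext fun f => hπwall x y hxy _ (hH.smul_mem g f.1 f.2.1)
  -- The fiber `F` need not be `G`-stable; it carries the action of the quotient `ρ`.
  let actF : MulAction G F := quotientAction hρsurj hρsmul
  let actC : MulAction G (H₀ → Bool) := quotientAction hπsurj hπsmul
  have hρequiv : ∀ (g : G) x, ρ (g • x) = g • ρ x := quotientAction_smul hρsurj hρsmul
  have hπequiv : ∀ (g : G) x, π (g • x) = g • π x := quotientAction_smul hπsurj hπsmul
  have hinj : Function.Injective fun x => (ρ x, π x) := by
    intro x y hxy
    have h1 := (hρiff x y).1 (congrArg Prod.fst hxy)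
    have h2 := hπwall x y (congrArg Prod.snd hxy)
    refine eq_of_forall_wall fun k hk => ?_
    by_cases hkH : k ∈ H
    · exact h2 k hkH
    · exact h1 k hk hkH
  have hsurj : Function.Surjective fun x => (ρ x, π x) := fun ⟨y, c⟩ => by
    obtain ⟨x, rfl, rfl⟩ := hjoint y c
    exact ⟨x, rfl⟩
  let e : M ≃ₜ F × (H₀ → Bool) := Continuous.homeoOfEquivCompactToT2
    (f := Equiv.ofBijective (fun x => (ρ x, π x)) ⟨hinj, hsurj⟩) (hρcont.prodMk hπcont)
  have hFtop : IsTopologicalG G F := by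
    refine ⟨⟨inferInstance, ?_⟩, ?_, isMedianMap_smul_of_surjective hρsurj hρmed hρequiv
      hM.isMedianMap_smul⟩
    · exact (hT.continuous_med.comp (by fun_prop :
        Continuous fun q : F × F × F => (q.1.1, q.2.1.1, q.2.2.1))).subtype_mk _
    · have : (fun q : G × F => q.1 • q.2) = fun q : G × F => ρ (q.1 • q.2.1) :=
        funext fun q => by rw [hρequiv, show ρ q.2.1 = q.2 from Subtype.ext (hpF _ q.2.2)]
      rw [this]
      exact hρcont.comp (hM.continuous_smul.comp
        (by fun_prop : Continuous fun q : G × F => (q.1, q.2.1)))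
  have hCtop : IsTopologicalG G (H₀ → Bool) := by
    refine ⟨⟨inferInstance, continuous_of_discreteTopology⟩, ?_,
      isMedianMap_smul_of_surjective hπsurj hπmed hπequiv hM.isMedianMap_smul⟩
    -- The cube is discrete, so continuity is checked along one orbit map at a time.
    rw [continuous_prod_of_discrete_right]
    intro c
    obtain ⟨x, rfl⟩ := hπsurj c
    simp only [← hπequiv]
    exact hπcont.comp (hM.continuous_smul.comp (by fun_prop : Continuous fun g : G => (g, x)))
  refine ⟨F, inferInstance, inferInstance, actF, H₀ → Bool, inferInstance, inferInstance, actC,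
    hFtop, hCtop, isFiniteCube_pi _, e, ⟨e.continuous, fun g x =>
      Prod.ext (hρequiv g x) (hπequiv g x), fun x y z => Prod.ext (hρmed x y z) (hπmed x y z)⟩, ?_⟩
  intro C' _ _ _ hC'G hC' φ hφ hφsurj
  have := hC'.finite_of_surjective hcount hφ.isMedianMap hφsurj
  have hφwall : ∀ x y, π x = π y → φ x = φ y := fun x y hxy => eq_of_forall_wall fun k hk => by
    by_contra hne
    refine hne (hπwall x y hxy (k ∘ φ)
      (hC'.comp_mem_transverseWalls hC'G hφ hφsurj hk ?_ ?_))
    · cases hx : k (φ x) <;> cases hy : k (φ y)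
      exacts [absurd (hx.trans hy.symm) hne, ⟨_, hy⟩, ⟨_, hx⟩, ⟨_, hx⟩]
    · cases hx : k (φ x) <;> cases hy : k (φ y)
      exacts [⟨_, hx⟩, ⟨_, hx⟩, ⟨_, hy⟩, absurd (hx.trans hy.symm) hne]
  let ψ : (H₀ → Bool) → C' := fun c => φ (Function.surjInv hπsurj c)
  have hψ : ∀ x, φ x = ψ (π x) := fun x => hφwall _ _ (Function.surjInv_eq hπsurj _).symm
  refine ⟨ψ, ⟨⟨continuous_of_discreteTopology, ?_, ?_⟩, hψ⟩, ?_⟩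
  · intro g c
    obtain ⟨x, rfl⟩ := hπsurj c
    rw [← hπequiv, ← hψ, ← hψ, hφ.map_smul]
  · intro a b c
    obtain ⟨x, rfl⟩ := hπsurj a
    obtain ⟨y, rfl⟩ := hπsurj b
    obtain ⟨z, rfl⟩ := hπsurj c
    rw [← hπmed, ← hψ, ← hψ, ← hψ, ← hψ, hφ.isMedianMap]
  · rintro ψ' ⟨-, hψ'⟩
    funext c
    obtain ⟨x, rfl⟩ := hπsurj c
    exact (hψ' x).symm.trans (hψ x)

end Main

end MedianAlgebra

theorem propositionA (G : Type w) [Group G] [TopologicalSpace G] [IsTopologicalGroup G]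
    (M : Type u) [TopologicalSpace M] [MedianAlgebra M] [MulAction G M]
    (hM : IsTopologicalG G M) (hsclocc : IsSclocc M) (hcount : HasCountableIntervals M)
    (hmin : IsMinimalAction G M) :
    ∃ (M' : Type u) (_ : TopologicalSpace M') (_ : MedianAlgebra M') (_ : MulAction G M')
      (C : Type u) (_ : TopologicalSpace C) (_ : MedianAlgebra C) (_ : MulAction G C),
      IsTopologicalG G M' ∧ IsTopologicalG G C ∧ IsFiniteCube C ∧
      ∃ e : M ≃ₜ M' × C, IsMorphism G e ∧
        ∀ (C' : Type v) [TopologicalSpace C'] [MedianAlgebra C'] [MulAction G C'],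
          IsTopologicalG G C' → IsCube C' →
          ∀ φ : M → C', IsMorphism G φ → Function.Surjective φ →
            ∃! ψ : C → C', IsMorphism G ψ ∧ ∀ x : M, φ x = ψ (e x).2 := by
  have := hsclocc.compact
  rcases isEmpty_or_nonempty M with _ | _
  · exact exists_cube_factor_of_isEmpty G M hM
  · exact exists_cube_factor_of_nonempty G M hM hcount hmin
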